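/- Let $k\ge 1$. A $k$-graph is a countable category $\Lambda$ with a functor $d:\Lambda\to\mathbb{N}^k$ (where $\mathbb{N}^k$ is a category with one object) such that, whenever $d(\lambda)=m+n$, there are unique morphisms $\mu,\nu$ with $d(\mu)=m$, $d(\nu)=n$ and $\lambda=\mu\nu$. Its morphisms are called paths, with range $r$ and source $s$; the set $\Lambda^0$ of objects (vertices) is identified with the set of paths of degree $0$, and $\Lambda^{\neq 0}$ denotes the set of paths of nonzero degree. For $v\in\Lambda^0$ and $n\in\mathbb{N}^k$ let $v\Lambda^n=\{\lambda : r(\lambda)=v,\ d(\lambda)=n\}$; $\Lambda$ is row-finite if every $v\Lambda^n$ is finite, and has no sources if every $v\Lambda^n$ is nonempty. A path $\lambda$ is closed if $r(\lambda)=s(\lambda)$. For a row-finite $k$-graph $\Lambda$ with no sources and a commutative ring $R$ with $1$, the Kumjian-Pask algebra $\mathrm{KP}_R(\Lambda)$ is the universal (not necessarily unital) associative $R$-algebra generated by elements $p_v$ ($v\in\Lambda^0$) and $s_\lambda, s_{\lambda^*}$ ($\lambda\in\Lambda^{\neq 0}$) subject to: (KP1) the $p_v$ are mutually orthogonal idempotents;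 (KP2) for $\lambda,\mu\in\Lambda^{\neq 0}$ with $r(\mu)=s(\lambda)$: $s_\lambda s_\mu=s_{\lambda\mu}$ and $s_{\mu^*}s_{\lambda^*}=s_{(\lambda\mu)^*}$; and for every $\lambda\in\Lambda^{\neq 0}$: $p_{r(\lambda)}s_\lambda=s_\lambda=s_\lambda p_{s(\lambda)}$ and $p_{s(\lambda)}s_{\lambda^*}=s_{\lambda^*}=s_{\lambda^*}p_{r(\lambda)}$; (KP3) $s_{\lambda^*}s_\mu=\delta_{\lambda,\mu}\,p_{s(\lambda)}$ for $\lambda,\mu\in\Lambda^{\neq 0}$ with $d(\lambda)=d(\mu)$; (KP4) $p_v=\sum_{\lambda\in v\Lambda^n}s_\lambda s_{\lambda^*}$ for $v\in\Lambda^0$ and $n\in\mathbb{N}^k\setminus\{0\}$. **Corollary.** Let $k\ge 1$, let $\Lambda$ be a row-finite $k$-graph with no sources, and let $R$ be a commutative ring with $1$. If $\Lambda$ has no closed paths of nonzero degree, then the center of $\mathrm{KP}_R(\Lambda)$ is $\{0\}$. -/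

import Mathlib

universe u v w x

open CategoryTheory (Category)
open scoped CategoryTheory

-- `a ⟶ b` should elaborate to the hom-set of the category directly
attribute [-instance] CategoryTheory.catToReflQuiver

/-- A `k`-graph: a countable category with a degree functor to `ℕ^k` (regarded as a category with
one object) that has the unique factorization property.  A morphism `f : a ⟶ b` is a path with
source `a` and range `b`; the product of paths `μν` (where the source of `μ` is the range of `ν`) is
the composite "first `ν`, then `μ`", which Mathlib writes `ν ≫ μ`. -/
structure KGraph (k : ℕ) where
  /-- the objects, that is, the vertices -/
  Vertex : Type u
  [cat : Category.{v} Vertex]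
  countable_vertex : Countable Vertex
  countable_hom : ∀ a b : Vertex, Countable (a ⟶ b)
  /-- the degree functor -/
  deg : ∀ {a b : Vertex}, (a ⟶ b) → Fin k → ℕ
  deg_id : ∀ a : Vertex, deg (𝟙 a) = 0
  deg_comp : ∀ {a b c : Vertex} (g : a ⟶ b) (f : b ⟶ c), deg (g ≫ f) = deg f + deg g
  /-- a path of degree `m + n` is in a unique way a product `μν` with `μ` of degree `m` and `ν` of
  degree `n` (here `p.2.1` is `ν` and `p.2.2` is `μ`) -/
  unique_factorization : ∀ {a c : Vertex} (f : a ⟶ c) (m n : Fin k → ℕ), deg f = m + n →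
    ∃! p : (Σ b : Vertex, (a ⟶ b) × (b ⟶ c)),
      deg p.2.2 = m ∧ deg p.2.1 = n ∧ p.2.1 ≫ p.2.2 = f

namespace KGraph

attribute [instance] KGraph.cat

variable {k : ℕ} (Λ : KGraph.{u, v} k)

/-- The paths of `Λ`, that is, all morphisms of the category. -/
structure Path where
  source : Λ.Vertex
  range : Λ.Vertex
  hom : source ⟶ range

variable {Λ} in
/-- The degree of a path. -/
def Path.degree (p : Λ.Path) : Fin k → ℕ := Λ.deg p.hom

variable {Λ} in
/-- A path is closed if its range and its source agree. -/
def Path.IsClosed (p : Λ.Path) : Prop := p.range = p.source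

/-- The set `vΛ^n` of paths of degree `n` with range `a`. -/
def pathsInto (a : Λ.Vertex) (n : Fin k → ℕ) : Set Λ.Path :=
  {p | p.range = a ∧ p.degree = n}

/-- `Λ` is row-finite if every `vΛ^n` is finite. -/
class RowFinite : Prop where
  finite_pathsInto : ∀ (a : Λ.Vertex) (n : Fin k → ℕ), (Λ.pathsInto a n).Finite

/-- `Λ` has no sources if every `vΛ^n` is nonempty. -/
def NoSources : Prop := ∀ (a : Λ.Vertex) (n : Fin k → ℕ), (Λ.pathsInto a n).Nonempty

noncomputable instance [Λ.RowFinite] (a : Λ.Vertex) (n : Fin k → ℕ) :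
    Fintype (Λ.pathsInto a n) :=
  (RowFinite.finite_pathsInto a n).fintype

/-- The set of paths that are not vertices, that is, the paths of nonzero degree. -/
def NonzeroPath : Type (max u v) := {p : Λ.Path // p.degree ≠ 0}

namespace NonzeroPath

variable {Λ}

/-- The source of a path of nonzero degree. -/
def source (p : Λ.NonzeroPath) : Λ.Vertex := p.1.source

/-- The range of a path of nonzero degree. -/
def range (p : Λ.NonzeroPath) : Λ.Vertex := p.1.range

/-- The degree of a path of nonzero degree. -/
def degree (p : Λ.NonzeroPath) : Fin k → ℕ := p.1.degree

/-- A morphism of nonzero degree as a path of nonzero degree. -/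
def of {a b : Λ.Vertex} (f : a ⟶ b) (hf : Λ.deg f ≠ 0) : Λ.NonzeroPath := ⟨⟨a, b, f⟩, hf⟩

/-- The product `fg` of two composable paths of nonzero degree. -/
def prod {a b c : Λ.Vertex} (f : b ⟶ c) (g : a ⟶ b) (hf : Λ.deg f ≠ 0) : Λ.NonzeroPath :=
  of (g ≫ f) (by rw [Λ.deg_comp]; exact fun h => hf (add_eq_zero.mp h).1)

end NonzeroPath

/-- An element of `vΛ^n`, where `n ≠ 0`, as a path of nonzero degree. -/
def pathsInto.nonzero {Λ : KGraph.{u, v} k} {a : Λ.Vertex} {n : Fin k → ℕ} (hn : n ≠ 0)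
    (p : Λ.pathsInto a n) : Λ.NonzeroPath :=
  ⟨p.1, fun h => hn (p.2.2.symm.trans h)⟩

open Classical in
/-- A Kumjian-Pask `Λ`-family in a (not necessarily unital) algebra `A`; `S p` is the
element of a path `p` and `T p` the element of the ghost path of `p`. -/
structure KPFamily [Λ.RowFinite] (A : Type x) [NonUnitalRing A] where
  P : Λ.Vertex → A
  S : Λ.NonzeroPath → A
  T : Λ.NonzeroPath → A
  kp1 : ∀ a b, P a * P b = if a = b then P a else 0
  kp2_path : ∀ {a b c : Λ.Vertex} (f : b ⟶ c) (g : a ⟶ b) (hf : Λ.deg f ≠ 0) (hg : Λ.deg g ≠ 0),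
    S (.of f hf) * S (.of g hg) = S (.prod f g hf)
  kp2_ghost : ∀ {a b c : Λ.Vertex} (f : b ⟶ c) (g : a ⟶ b) (hf : Λ.deg f ≠ 0) (hg : Λ.deg g ≠ 0),
    T (.of g hg) * T (.of f hf) = T (.prod f g hf)
  kp2_range_path : ∀ p, P p.range * S p = S p
  kp2_path_source : ∀ p, S p * P p.source = S p
  kp2_source_ghost : ∀ p, P p.source * T p = T p
  kp2_ghost_range : ∀ p, T p * P p.range = T p
  kp3 : ∀ p q, p.degree = q.degree → T p * S q = if p = q then P p.source else 0
  kp4 : ∀ (a : Λ.Vertex) (n : Fin k → ℕ) (hn : n ≠ 0),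
    P a = ∑ p : Λ.pathsInto a n, S (pathsInto.nonzero hn p) * T (pathsInto.nonzero hn p)

/-- The generators of the Kumjian-Pask algebra: vertices, paths of nonzero degree, and ghost paths
of nonzero degree. -/
inductive Gen : Type (max u v)
  | vertex (a : Λ.Vertex)
  | path (p : Λ.NonzeroPath)
  | ghost (p : Λ.NonzeroPath)

variable (R : Type w) [CommRing R]

/-- The free non-unital associative `R`-algebra on the generators: the semigroup algebra of the
nonempty words. -/
abbrev FreeAlg : Type (max u v w) := MonoidAlgebra R (FreeSemigroup Λ.Gen)

/-- A generator as an element of the free non-unital algebra. -/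
noncomputable def gen (g : Λ.Gen) : Λ.FreeAlg R := MonoidAlgebra.single (FreeSemigroup.of g) 1

open Classical in
/-- The Kumjian-Pask relations in the free non-unital algebra. -/
inductive Rel [Λ.RowFinite] : Λ.FreeAlg R → Λ.FreeAlg R → Prop
  | kp1 (a b : Λ.Vertex) : Rel (Λ.gen R (.vertex a) * Λ.gen R (.vertex b))
      (if a = b then Λ.gen R (.vertex a) else 0)
  | kp2_path {a b c : Λ.Vertex} (f : b ⟶ c) (g : a ⟶ b) (hf : Λ.deg f ≠ 0) (hg : Λ.deg g ≠ 0) :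
      Rel (Λ.gen R (.path (.of f hf)) * Λ.gen R (.path (.of g hg)))
        (Λ.gen R (.path (.prod f g hf)))
  | kp2_ghost {a b c : Λ.Vertex} (f : b ⟶ c) (g : a ⟶ b) (hf : Λ.deg f ≠ 0) (hg : Λ.deg g ≠ 0) :
      Rel (Λ.gen R (.ghost (.of g hg)) * Λ.gen R (.ghost (.of f hf)))
        (Λ.gen R (.ghost (.prod f g hf)))
  | kp2_range_path (p : Λ.NonzeroPath) :
      Rel (Λ.gen R (.vertex p.range) * Λ.gen R (.path p)) (Λ.gen R (.path p))
  | kp2_path_source (p : Λ.NonzeroPath) :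
      Rel (Λ.gen R (.path p) * Λ.gen R (.vertex p.source)) (Λ.gen R (.path p))
  | kp2_source_ghost (p : Λ.NonzeroPath) :
      Rel (Λ.gen R (.vertex p.source) * Λ.gen R (.ghost p)) (Λ.gen R (.ghost p))
  | kp2_ghost_range (p : Λ.NonzeroPath) :
      Rel (Λ.gen R (.ghost p) * Λ.gen R (.vertex p.range)) (Λ.gen R (.ghost p))
  | kp3 (p q : Λ.NonzeroPath) (h : p.degree = q.degree) :
      Rel (Λ.gen R (.ghost p) * Λ.gen R (.path q))
        (if p = q then Λ.gen R (.vertex p.source) else 0)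
  | kp4 (a : Λ.Vertex) (n : Fin k → ℕ) (hn : n ≠ 0) :
      Rel (Λ.gen R (.vertex a))
        (∑ p : Λ.pathsInto a n, Λ.gen R (.path (pathsInto.nonzero hn p)) *
          Λ.gen R (.ghost (pathsInto.nonzero hn p)))

/-- The Kumjian-Pask relations and their scalar multiples (in a non-unital `R`-algebra a ring ideal
need not be closed under scalars). -/
inductive SRel [Λ.RowFinite] : Λ.FreeAlg R → Λ.FreeAlg R → Prop
  | smul (c : R) {f g : Λ.FreeAlg R} (h : Λ.Rel R f g) : SRel (c • f) (c • g)

/-- The congruence on the free non-unital `R`-algebra that the Kumjian-Pask relations generate. -/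
noncomputable def kpCon [Λ.RowFinite] : RingCon (Λ.FreeAlg R) := ringConGen (Λ.SRel R)

theorem kpCon_smul [Λ.RowFinite] (c : R) {f g : Λ.FreeAlg R} (h : Λ.kpCon R f g) :
    Λ.kpCon R (c • f) (c • g) := by
  have key : ∀ {f g : Λ.FreeAlg R}, RingConGen.Rel (Λ.SRel R) f g →
      ∀ c : R, RingConGen.Rel (Λ.SRel R) (c • f) (c • g) := by
    intro f g h
    induction h with
    | of f g h =>
      intro c
      obtain ⟨d, h⟩ := h
      rw [smul_smul, smul_smul]
      exact .of _ _ ⟨c * d, h⟩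
    | refl f => exact fun c => .refl _
    | symm _ ih => exact fun c => .symm (ih c)
    | trans _ _ ih₁ ih₂ => exact fun c => .trans (ih₁ c) (ih₂ c)
    | add _ _ ih₁ ih₂ =>
      intro c
      rw [smul_add, smul_add]
      exact .add (ih₁ c) (ih₂ c)
    | mul _ h₂ ih₁ _ =>
      intro c
      rw [← smul_mul_assoc, ← smul_mul_assoc]
      exact .mul (ih₁ c) h₂
  exact key h c

/-- The Kumjian-Pask algebra `KP_R(Λ)`: the universal non-unital `R`-algebra on the generators
subject to the Kumjian-Pask relations. -/
def KumjianPask [Λ.RowFinite] : Type (max u v w) := (Λ.kpCon R).Quotient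

namespace KumjianPask

variable [Λ.RowFinite]

noncomputable instance : NonUnitalRing (Λ.KumjianPask R) :=
  inferInstanceAs (NonUnitalRing (Λ.kpCon R).Quotient)

/-- The quotient map from the free non-unital algebra. -/
noncomputable def mk (f : Λ.FreeAlg R) : Λ.KumjianPask R := (f : (Λ.kpCon R).Quotient)

variable {Λ R}

theorem mk_surjective : Function.Surjective (mk Λ R) := Quotient.mk''_surjective

theorem mk_eq_iff {f g : Λ.FreeAlg R} : mk Λ R f = mk Λ R g ↔ Λ.kpCon R f g :=
  (Λ.kpCon R).eq

theorem mk_add (f g : Λ.FreeAlg R) : mk Λ R (f + g) = mk Λ R f + mk Λ R g := rfl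

theorem mk_mul (f g : Λ.FreeAlg R) : mk Λ R (f * g) = mk Λ R f * mk Λ R g := rfl

theorem mk_zero : mk Λ R 0 = 0 := rfl

noncomputable instance : SMul R (Λ.KumjianPask R) where
  smul c := Quotient.map' (c • ·) fun _ _ h => Λ.kpCon_smul R c h

theorem mk_smul (c : R) (f : Λ.FreeAlg R) : mk Λ R (c • f) = c • mk Λ R f := rfl

noncomputable instance : Module R (Λ.KumjianPask R) :=
  Function.Surjective.module R
    (⟨⟨mk Λ R, mk_zero⟩, mk_add⟩ : Λ.FreeAlg R →+ Λ.KumjianPask R) mk_surjective mk_smul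

instance : IsScalarTower R (Λ.KumjianPask R) (Λ.KumjianPask R) where
  smul_assoc c f g := by
    obtain ⟨f, rfl⟩ := mk_surjective f
    obtain ⟨g, rfl⟩ := mk_surjective g
    simp only [smul_eq_mul, ← mk_smul, ← mk_mul, smul_mul_assoc]

instance : SMulCommClass R (Λ.KumjianPask R) (Λ.KumjianPask R) where
  smul_comm c f g := by
    obtain ⟨f, rfl⟩ := mk_surjective f
    obtain ⟨g, rfl⟩ := mk_surjective g
    simp only [smul_eq_mul, ← mk_smul, ← mk_mul, mul_smul_comm]

/-- The quotient map as a homomorphism of non-unital `R`-algebras. -/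
noncomputable def mkHom : Λ.FreeAlg R →ₙₐ[R] Λ.KumjianPask R where
  toFun := mk Λ R
  map_smul' := mk_smul
  map_zero' := mk_zero
  map_add' := mk_add
  map_mul' := mk_mul

theorem mk_rel {f g : Λ.FreeAlg R} (h : Λ.Rel R f g) : mk Λ R f = mk Λ R g := by
  have h' := RingConGen.Rel.of _ _ (SRel.smul (1 : R) h)
  rw [one_smul, one_smul] at h'
  exact mk_eq_iff.2 h'

variable (Λ R) in
/-- The generating Kumjian-Pask family `(p, s)` of `KP_R(Λ)`. -/
noncomputable def family : Λ.KPFamily (Λ.KumjianPask R) where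
  P a := mk Λ R (Λ.gen R (.vertex a))
  S p := mk Λ R (Λ.gen R (.path p))
  T p := mk Λ R (Λ.gen R (.ghost p))
  kp1 a b := by rw [← mk_mul, mk_rel (.kp1 a b)]; split_ifs <;> rfl
  kp2_path f g hf hg := by rw [← mk_mul, mk_rel (.kp2_path f g hf hg)]
  kp2_ghost f g hf hg := by rw [← mk_mul, mk_rel (.kp2_ghost f g hf hg)]
  kp2_range_path p := by rw [← mk_mul, mk_rel (.kp2_range_path p)]
  kp2_path_source p := by rw [← mk_mul, mk_rel (.kp2_path_source p)]
  kp2_source_ghost p := by rw [← mk_mul, mk_rel (.kp2_source_ghost p)]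
  kp2_ghost_range p := by rw [← mk_mul, mk_rel (.kp2_ghost_range p)]
  kp3 p q h := by rw [← mk_mul, mk_rel (.kp3 p q h)]; split_ifs <;> rfl
  kp4 a n hn := by
    rw [mk_rel (.kp4 a n hn)]
    exact map_sum (mkHom (Λ := Λ) (R := R)) _ _

variable {A : Type x} [NonUnitalRing A] [Module R A] [IsScalarTower R A A] [SMulCommClass R A A]

/-- The value of a Kumjian-Pask family at a generator. -/
def _root_.KGraph.KPFamily.val (Q : Λ.KPFamily A) : Λ.Gen → A
  | .vertex a => Q.P a
  | .path p => Q.S p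
  | .ghost p => Q.T p

variable (R) in
/-- The homomorphism on the free non-unital algebra given by a Kumjian-Pask family. -/
noncomputable def freeLift (Q : Λ.KPFamily A) : Λ.FreeAlg R →ₙₐ[R] A :=
  MonoidAlgebra.liftMagma R (FreeSemigroup.lift Q.val)

theorem freeLift_gen (Q : Λ.KPFamily A) (g : Λ.Gen) : freeLift R Q (Λ.gen R g) = Q.val g := by
  simp [freeLift, gen]

theorem freeLift_rel (Q : Λ.KPFamily A) {f g : Λ.FreeAlg R} (h : Λ.Rel R f g) :
    freeLift R Q f = freeLift R Q g := by
  induction h with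
  | kp1 a b =>
    rw [map_mul, freeLift_gen, freeLift_gen]
    refine (Q.kp1 a b).trans ?_
    split_ifs
    · rw [freeLift_gen]; rfl
    · rw [map_zero]
  | kp2_path f g hf hg => simpa only [map_mul, freeLift_gen, KPFamily.val] using Q.kp2_path f g hf hg
  | kp2_ghost f g hf hg => simpa only [map_mul, freeLift_gen, KPFamily.val] using Q.kp2_ghost f g hf hg
  | kp2_range_path p => simpa only [map_mul, freeLift_gen, KPFamily.val] using Q.kp2_range_path p
  | kp2_path_source p => simpa only [map_mul, freeLift_gen, KPFamily.val] using Q.kp2_path_source p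
  | kp2_source_ghost p => simpa only [map_mul, freeLift_gen, KPFamily.val] using Q.kp2_source_ghost p
  | kp2_ghost_range p => simpa only [map_mul, freeLift_gen, KPFamily.val] using Q.kp2_ghost_range p
  | kp3 p q h =>
    rw [map_mul, freeLift_gen, freeLift_gen]
    refine (Q.kp3 p q h).trans ?_
    split_ifs
    · rw [freeLift_gen]; rfl
    · rw [map_zero]
  | kp4 a n hn =>
    simp only [map_sum, map_mul, freeLift_gen]
    exact Q.kp4 a n hn

theorem freeLift_kpCon (Q : Λ.KPFamily A) {f g : Λ.FreeAlg R} (h : Λ.kpCon R f g) :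
    freeLift R Q f = freeLift R Q g := by
  have key : ∀ {f g : Λ.FreeAlg R}, RingConGen.Rel (Λ.SRel R) f g →
      freeLift R Q f = freeLift R Q g := by
    intro f g h
    induction h with
    | of f g h =>
      obtain ⟨c, h⟩ := h
      rw [map_smul, map_smul, freeLift_rel Q h]
    | refl f => rfl
    | symm _ ih => exact ih.symm
    | trans _ _ ih₁ ih₂ => exact ih₁.trans ih₂
    | add _ _ ih₁ ih₂ => rw [map_add, map_add, ih₁, ih₂]
    | mul _ _ ih₁ ih₂ => rw [map_mul, map_mul, ih₁, ih₂]
  exact key h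

variable (R) in
/-- The homomorphism from `KP_R(Λ)` given by a Kumjian-Pask family. -/
noncomputable def lift (Q : Λ.KPFamily A) : Λ.KumjianPask R →ₙₐ[R] A where
  toFun := Quotient.lift (freeLift R Q) fun _ _ h => freeLift_kpCon Q h
  map_smul' c f := by
    obtain ⟨f, rfl⟩ := mk_surjective f
    exact map_smul (freeLift R Q) c f
  map_zero' := map_zero (freeLift R Q)
  map_add' f g := by
    obtain ⟨f, rfl⟩ := mk_surjective f
    obtain ⟨g, rfl⟩ := mk_surjective g
    exact map_add (freeLift R Q) f g
  map_mul' f g := by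
    obtain ⟨f, rfl⟩ := mk_surjective f
    obtain ⟨g, rfl⟩ := mk_surjective g
    exact map_mul (freeLift R Q) f g

/-- The universal property of the Kumjian-Pask algebra. -/
theorem existsUnique_hom (Q : Λ.KPFamily A) :
    ∃! φ : Λ.KumjianPask R →ₙₐ[R] A, (∀ a, φ ((family Λ R).P a) = Q.P a) ∧
      (∀ p, φ ((family Λ R).S p) = Q.S p) ∧ (∀ p, φ ((family Λ R).T p) = Q.T p) := by
  refine ⟨lift R Q, ⟨fun a => freeLift_gen Q (.vertex a), fun p => freeLift_gen Q (.path p),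
    fun p => freeLift_gen Q (.ghost p)⟩, ?_⟩
  rintro φ ⟨h₁, h₂, h₃⟩
  have hcomp : φ.comp mkHom = freeLift R Q := by
    refine (MonoidAlgebra.liftMagma R).symm.injective (FreeSemigroup.hom_ext (funext fun g => ?_))
    have h : φ (mk Λ R (Λ.gen R g)) = freeLift R Q (Λ.gen R g) := by
      rw [freeLift_gen]
      cases g with
      | vertex a => exact h₁ a
      | path p => exact h₂ p
      | ghost p => exact h₃ p
    exact h
  ext f
  obtain ⟨f, rfl⟩ := mk_surjective f
  exact DFunLike.congr_fun hcomp f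

end KumjianPask

end KGraph

namespace KGraph

variable {k : ℕ} (Λ : KGraph.{u, v} k)

/-! Let `z` be central and let `V` be the set of vertices `a` with `z p_a ≠ 0`. Finite sums of
vertex projections are local units (`exists_mul_sum_P_eq`), so `z = z ∑_{a ∈ F} p_a` for a finite
`F`; by orthogonality `V ⊆ F`, and `z = 0` once `V` is empty.

For `a` in `V` and `n ≠ 0`, (KP4) and centrality give `z p_a = ∑ s_λ (z p_{s(λ)}) s_{λ^*}` over `λ ∈
aΛ^n`, so some such `λ` has its source in `V` (`exists_mul_P_source_ne_zero`). Going backwards along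
paths of nonzero degree thus never leaves the finite set `V`. If `V` were nonempty, a vertex would
have to recur, which would give a closed path of nonzero degree. -/

/-- There is a path of nonzero degree with source `a` and range `b`. -/
def Precedes (a b : Λ.Vertex) : Prop := ∃ f : a ⟶ b, Λ.deg f ≠ 0

theorem Precedes.trans {Λ : KGraph.{u, v} k} {a b c : Λ.Vertex}
    (hab : Λ.Precedes a b) (hbc : Λ.Precedes b c) : Λ.Precedes a c := by
  obtain ⟨g, _⟩ := hab
  obtain ⟨f, hf⟩ := hbc
  exact ⟨g ≫ f, by rw [Λ.deg_comp]; exact fun h => hf (add_eq_zero.mp h).1⟩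

theorem exists_isClosed_of_precedes_self {Λ : KGraph.{u, v} k} {a : Λ.Vertex}
    (h : Λ.Precedes a a) : ∃ p : Λ.Path, p.degree ≠ 0 ∧ p.IsClosed :=
  h.elim fun f hf => ⟨⟨a, a, f⟩, hf, rfl⟩

/-- Without closed paths of nonzero degree, a finite set of vertices in which every vertex is
preceded by another one is empty. -/
theorem eq_empty_of_forall_exists_precedes {Λ : KGraph.{u, v} k}
    (hclosed : ¬ ∃ p : Λ.Path, p.degree ≠ 0 ∧ p.IsClosed) {V : Set Λ.Vertex} (hV : V.Finite)
    (h : ∀ b ∈ V, ∃ a ∈ V, Λ.Precedes a b) : V = ∅ := by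
  by_contra hne
  obtain ⟨b₀, hb₀⟩ := Set.nonempty_iff_ne_empty.mpr hne
  have : Finite V := hV
  let r : V → V → Prop := fun a b => Λ.Precedes a b
  have : IsTrans V r := ⟨fun _ _ _ => Precedes.trans⟩
  have : Std.Irrefl r := ⟨fun _ h => hclosed (exists_isClosed_of_precedes_self h)⟩
  -- The recurrence argument in order form: a strict order on a nonempty finite set has a minimal
  -- element, which contradicts `h`.
  obtain ⟨b, -, hb⟩ := (Finite.wellFounded_of_trans_of_irrefl r).has_min Set.univ ⟨⟨b₀, hb₀⟩, trivial⟩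
  obtain ⟨a, ha, hab⟩ := h b b.2
  exact hb ⟨a, ha⟩ trivial hab

namespace KPFamily

variable {Λ} [Λ.RowFinite] {A : Type x} [NonUnitalRing A] (Q : Λ.KPFamily A)

theorem sum_P_mul_P_of_mem {F : Finset Λ.Vertex} {a : Λ.Vertex} (ha : a ∈ F) :
    (∑ b ∈ F, Q.P b) * Q.P a = Q.P a := by
  classical
  simp [Finset.sum_mul, Q.kp1, ha]

theorem sum_P_mul_P_of_notMem {F : Finset Λ.Vertex} {a : Λ.Vertex} (ha : a ∉ F) :
    (∑ b ∈ F, Q.P b) * Q.P a = 0 := by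
  classical
  simp [Finset.sum_mul, Q.kp1, ha]

theorem sum_P_mul_sum_P_of_subset {F G : Finset Λ.Vertex} (h : F ⊆ G) :
    (∑ b ∈ F, Q.P b) * ∑ a ∈ G, Q.P a = ∑ b ∈ F, Q.P b := by
  classical
  rw [Finset.mul_sum, ← Finset.sum_subset h fun a _ ha => Q.sum_P_mul_P_of_notMem ha]
  exact Finset.sum_congr rfl fun a ha => Q.sum_P_mul_P_of_mem ha

/-- A local unit of `z` may be enlarged, so two elements have a common one, indexed by the union of
their vertex sets. -/
theorem mul_sum_P_of_subset {z : A} {F G : Finset Λ.Vertex} (h : F ⊆ G)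
    (hz : z * ∑ a ∈ F, Q.P a = z) : z * ∑ a ∈ G, Q.P a = z := by
  rw [← hz, mul_assoc, Q.sum_P_mul_sum_P_of_subset h]

/-- Every element in the range of a Kumjian-Pask family is fixed by right multiplication by a
vertex projection. -/
theorem exists_val_mul_P (g : Λ.Gen) : ∃ a, Q.val g * Q.P a = Q.val g := by
  cases g with
  | vertex a => exact ⟨a, by simp [val, Q.kp1]⟩
  | path p => exact ⟨_, Q.kp2_path_source p⟩
  | ghost p => exact ⟨_, Q.kp2_ghost_range p⟩

/-- If a central `z` does not vanish at a vertex `a`, then for each `n ≠ 0` it does not vanish at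
the source of some path in `aΛ^n`. -/
theorem exists_mul_P_source_ne_zero {z : A} (hz : z ∈ Set.center A) {a : Λ.Vertex}
    (ha : z * Q.P a ≠ 0) {n : Fin k → ℕ} (hn : n ≠ 0) :
    ∃ p : Λ.pathsInto a n, z * Q.P p.1.source ≠ 0 := by
  by_contra! h
  refine ha ?_
  rw [Q.kp4 a n hn, Finset.mul_sum]
  refine Finset.sum_eq_zero fun p _ => ?_
  have hp : z * Q.P (pathsInto.nonzero hn p).source = 0 := h p
  -- Centrality moves `z` past `s_λ`, next to `s_{λ^*} = p_{s(λ)} s_{λ^*}`, where `z p_{s(λ)} = 0`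
  -- applies.
  rw [← mul_assoc, (Set.mem_center_iff.mp hz).comm, mul_assoc,
    ← Q.kp2_source_ghost, ← mul_assoc z, hp, zero_mul, mul_zero]

end KPFamily

namespace KumjianPask

variable {Λ} [Λ.RowFinite] {R : Type w} [CommRing R]

/-- The finite sums of vertex projections are local units of the Kumjian-Pask algebra. -/
theorem exists_mul_sum_P_eq (z : Λ.KumjianPask R) :
    ∃ F : Finset Λ.Vertex, z * ∑ a ∈ F, (family Λ R).P a = z := by
  classical
  obtain ⟨f, rfl⟩ := mk_surjective z
  induction f using MonoidAlgebra.induction_linear with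
  | zero => exact ⟨∅, by rw [mk_zero, zero_mul]⟩
  | add f g hf hg =>
    obtain ⟨F, hF⟩ := hf
    obtain ⟨G, hG⟩ := hg
    refine ⟨F ∪ G, ?_⟩
    rw [mk_add, add_mul, (family Λ R).mul_sum_P_of_subset Finset.subset_union_left hF,
      (family Λ R).mul_sum_P_of_subset Finset.subset_union_right hG]
  | single w c =>
    have hword : ∃ F : Finset Λ.Vertex,
        mk Λ R (MonoidAlgebra.single w 1) * ∑ a ∈ F, (family Λ R).P a =
          mk Λ R (MonoidAlgebra.single w 1) := by
      induction w using FreeSemigroup.recOnMul with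
      | ih1 g =>
        obtain ⟨a, ha⟩ := (family Λ R).exists_val_mul_P g
        have hg : (family Λ R).val g = mk Λ R (Λ.gen R g) := by cases g <;> rfl
        refine ⟨{a}, ?_⟩
        rw [hg] at ha
        rwa [Finset.sum_singleton]
      | ih2 g w _ hw =>
        obtain ⟨F, hF⟩ := hw
        refine ⟨F, ?_⟩
        -- Right multiplication only meets the end of a word, so a local unit of the tail `w` also
        -- serves the longer word.
        rw [← one_mul (1 : R), ← MonoidAlgebra.single_mul_single, mk_mul, mul_assoc, hF]
    obtain ⟨F, hF⟩ := hword
    refine ⟨F, ?_⟩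
    have hc : MonoidAlgebra.single w c = c • MonoidAlgebra.single w (1 : R) := by simp
    rw [hc, mk_smul, smul_mul_assoc, hF]

end KumjianPask

end KGraph

theorem mainTheorem4 {k : ℕ} (hk : 1 ≤ k) (Λ : KGraph.{u, v} k) [Λ.RowFinite]
    (hΛ : Λ.NoSources) (hclosed : ¬ ∃ p : Λ.Path, p.degree ≠ 0 ∧ p.IsClosed)
    (R : Type w) [CommRing R] :
    Set.center (Λ.KumjianPask R) = {0} := by
  let Q := KGraph.KumjianPask.family Λ R
  refine Set.Subset.antisymm (fun z hz => ?_) (Set.singleton_subset_iff.mpr Set.zero_mem_center)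
  obtain ⟨F, hF⟩ := KGraph.KumjianPask.exists_mul_sum_P_eq z
  have hfin : {a | z * Q.P a ≠ 0}.Finite := F.finite_toSet.subset fun a ha => by
    by_contra haF
    refine ha ?_
    -- For `a ∉ F`, `z p_a = z (∑_{b ∈ F} p_b) p_a = 0` by orthogonality.
    rw [← hF, mul_assoc]
    exact (congrArg (z * ·) (Q.sum_P_mul_P_of_notMem haF)).trans (mul_zero z)
  -- Any nonzero degree would do; `(1, …, 1)` is nonzero because `k ≥ 1`.
  have hn : (1 : Fin k → ℕ) ≠ 0 := fun h => one_ne_zero (congrFun h ⟨0, hk⟩)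
  have hempty := KGraph.eq_empty_of_forall_exists_precedes hclosed hfin fun a ha => by
    obtain ⟨⟨⟨b, _, f⟩, rfl, hf⟩, hb⟩ := Q.exists_mul_P_source_ne_zero hz ha hn
    exact ⟨b, hb, f, fun h => hn (hf.symm.trans h)⟩
  rw [Set.mem_singleton_iff, ← hF, Finset.mul_sum]
  refine Finset.sum_eq_zero fun a _ => ?_
  -- A nonzero summand `z p_a` would put `a` into the empty set `V`.
  by_contra ha
  exact Set.eq_empty_iff_forall_notMem.mp hempty a ha
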